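/- Let $R$ be a commutative noetherian ring. An $R$-module $L$ is \emph{mini-max} if it has a noetherian submodule $N\subseteq L$ such that $L/N$ is artinian. Let $E_R=\bigoplus_{\mathfrak m}\operatorname{E}_R(R/\mathfrak m)$, where $\mathfrak m$ runs over all maximal ideals of $R$ and $\operatorname{E}_R$ denotes the injective hull; an $R$-module $L$ is \emph{Matlis reflexive} if the natural biduality map $L\to\operatorname{Hom}_R(\operatorname{Hom}_R(L,E_R),E_R)$, $l\mapsto(\psi\mapsto\psi(l))$, is an isomorphism. A ring is \emph{semi-local} if it has only finitely many maximal ideals, and \emph{complete} if it is complete (and separated) with respect to the adic topology of its Jacobson radical. Let $M$ and $M'$ be mini-max $R$-modules and let $i\geq 0$. Then: \begin{enumerate} \item[(1)] $\operatorname{Tor}_i^R(M,M')$ is a mini-max $R$-module. \item[(2)] If the quotient ring $R/(\operatorname{Ann}_R(M)+\operatorname{Ann}_R(M'))$ is semi-local and complete, then $\operatorname{Tor}_i^R(M,M')$ is a Matlis reflexive $R$-module. \item[(3)] If $R/(\operatorname{Ann}_R(M)+\operatorname{Ann}_R(M'))$ is artinian, then $\operatorname{Tor}_i^R(M,M')$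 has finite length over $R$. \end{enumerate} -/

import Mathlib

universe u

namespace MatlisTor

/-- An `R`-module `L` is mini-max if it has a noetherian submodule with artinian quotient. -/
def IsMinimax (R L : Type*) [CommRing R] [AddCommGroup L] [Module R L] : Prop :=
  ∃ N : Submodule R L, IsNoetherian R N ∧ IsArtinian R (L ⧸ N)

/-- A commutative ring is semi-local if it has only finitely many maximal ideals. -/
def IsSemilocal (S : Type*) [CommRing S] : Prop :=
  Finite (MaximalSpectrum S)

/-- A ring is complete if it is complete (and separated) in the adic topology of its
Jacobson radical. -/
def IsJacobsonComplete (S : Type*) [CommRing S] : Prop :=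
  IsAdicComplete (Ring.jacobson S) S

/-- `f : L → E` is an injective hull of `L`: `E` is an injective module, `f` is a monomorphism,
and the extension `f` is essential. -/
structure IsInjectiveHull {R L E : Type u} [CommRing R] [AddCommGroup L] [Module R L]
    [AddCommGroup E] [Module R E] (f : L →ₗ[R] E) : Prop where
  injective_module : Module.Injective R E
  injective : Function.Injective f
  essential : ∀ N : Submodule R E, N ⊓ LinearMap.range f = ⊥ → N = ⊥

/-- A submodule all of whose elements satisfy `P` lies in a maximal one with this property. -/
theorem exists_maximal_submodule {R I : Type u} [CommRing R] [AddCommGroup I] [Module R I]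
    (P : I → Prop) (A : Submodule R I) (hA : ∀ x ∈ A, P x) :
    ∃ K : Submodule R I, A ≤ K ∧ (∀ x ∈ K, P x) ∧
      ∀ K' : Submodule R I, K ≤ K' → (∀ x ∈ K', P x) → K' = K := by
  obtain ⟨K, hAK, hK⟩ := zorn_le_nonempty₀ {K : Submodule R I | ∀ x ∈ K, P x}
    (fun c hc hch y hy => ⟨sSup c, fun x hx => by
      obtain ⟨z, hz, hxz⟩ := (Submodule.mem_sSup_of_directed ⟨y, hy⟩ hch.directedOn).1 hx
      exact hc hz x hxz, fun z hz => le_sSup hz⟩) A hA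
  exact ⟨K, hAK, hK.1, fun K' h h' => le_antisymm (hK.2 h' h) h⟩

/-- Every module has an injective hull. -/
theorem exists_injectiveHull (R L : Type u) [CommRing R] [AddCommGroup L] [Module R L] :
    ∃ (E : ModuleCat.{u} R) (f : L →ₗ[R] E), IsInjectiveHull f := by
  obtain ⟨I, hI, j, hj⟩ : ∃ (I : ModuleCat.{u} R) (_ : Module.Injective R I) (j : L →ₗ[R] I),
      Function.Injective j := by
    obtain ⟨J, hJ, f, hf⟩ := CategoryTheory.EnoughInjectives.presentation (ModuleCat.of R L)
    exact ⟨J, (Module.injective_iff_injective_object R J).2 hJ, f.hom,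
      (ModuleCat.mono_iff_injective f).1 hf⟩
  -- a maximal essential extension `E` of `L` inside `I`
  obtain ⟨E, hLE, hE, hEmax⟩ := exists_maximal_submodule
    (fun x : I => x ≠ 0 → ∃ r : R, r • x ≠ 0 ∧ r • x ∈ LinearMap.range j) (LinearMap.range j)
    (fun x hx hx0 => ⟨1, by simpa using hx0, by simpa using hx⟩)
  -- a maximal submodule `K` with zero intersection with `E`
  obtain ⟨K, -, hK, hKmax⟩ := exists_maximal_submodule
    (fun x : I => x ∈ E → x = 0) ⊥ (fun x hx _ => (Submodule.mem_bot R).1 hx)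
  obtain ⟨φ, hφ⟩ := hI.out (K.mkQ ∘ₗ E.subtype)
    (by
      rw [← LinearMap.ker_eq_bot, LinearMap.ker_eq_bot']
      intro x hx
      have : (x : I) ∈ K := by simpa using hx
      exact Subtype.ext (hK _ this x.2)) E.subtype
  set ψ : I →ₗ[R] I := φ ∘ₗ K.mkQ with hψ
  have hψE : ∀ x ∈ E, ψ x = x := fun x hx => hφ ⟨x, hx⟩
  have hker : LinearMap.ker ψ = K := by
    refine hKmax _ (fun x hx => ?_) (fun x hx hxE => ?_)
    · have : K.mkQ x = 0 := by simpa using hx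
      simp only [LinearMap.mem_ker, hψ, LinearMap.comp_apply, this, map_zero]
    · rw [← hψE x hxE]; exact hx
  have hrange : LinearMap.range ψ = E := by
    refine hEmax _ (fun x hx => ⟨x, hψE x hx⟩) ?_
    rintro _ ⟨y, rfl⟩ hy
    by_contra hcon
    -- otherwise `K + R y` would still meet `E` trivially
    have hyK : K ⊔ Submodule.span R {y} = K := by
      refine hKmax _ le_sup_left ?_
      intro z hz hzE
      obtain ⟨k, hk, w, hw, rfl⟩ := Submodule.mem_sup.1 hz
      obtain ⟨r, rfl⟩ := Submodule.mem_span_singleton.1 hw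
      have hk0 : ψ k = 0 := by rw [← LinearMap.mem_ker, hker]; exact hk
      have h1 : k + r • y = r • ψ y := by
        rw [← hψE _ hzE, map_add, hk0, zero_add, map_smul]
      by_contra hne
      obtain ⟨s, hs0, hs⟩ := hE _ hzE hne
      rw [h1, smul_smul] at hs0 hs
      exact hcon ⟨s * r, hs0, hs⟩
    apply hy
    rw [← LinearMap.mem_ker, hker, ← hyK]
    exact Submodule.mem_sup_right (Submodule.mem_span_singleton_self y)
  refine ⟨ModuleCat.of R E, LinearMap.codRestrict E j (fun x => hLE ⟨x, rfl⟩), ?_, ?_, ?_⟩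
  · refine ⟨fun X Y _ _ _ _ f hf g => ?_⟩
    obtain ⟨h, hh⟩ := hI.out f hf (E.subtype ∘ₗ g)
    refine ⟨LinearMap.codRestrict E (ψ ∘ₗ h) (fun x => hrange ▸ ⟨h x, rfl⟩), fun x => ?_⟩
    apply Subtype.ext
    change ψ (h (f x)) = _
    rw [hh]
    exact hψE _ (g x).2
  · intro x y hxy
    exact hj (congrArg Subtype.val hxy)
  · intro N hN
    rw [eq_bot_iff]
    intro x hx
    by_contra hx0
    have hx0' : (x : I) ≠ 0 := fun h => hx0 (by
      rw [Submodule.mem_bot]; exact Subtype.ext h)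
    obtain ⟨r, hr0, l, hl⟩ := hE x.1 x.2 hx0'
    have : r • x ∈ (⊥ : Submodule R E) := by
      rw [← hN]
      exact ⟨N.smul_mem r hx, l, Subtype.ext hl⟩
    exact hr0 (congrArg Subtype.val ((Submodule.mem_bot R).1 this))

/-- A chosen injective hull `E_R(L)` of the module `L` (it is unique up to isomorphism). -/
noncomputable def injectiveHull (R L : Type u) [CommRing R] [AddCommGroup L] [Module R L] :
    ModuleCat.{u} R :=
  (exists_injectiveHull R L).choose

/-- The chosen injective hull is an injective hull. -/
theorem injectiveHull_spec (R L : Type u) [CommRing R] [AddCommGroup L] [Module R L] :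
    ∃ f : L →ₗ[R] injectiveHull R L, IsInjectiveHull f :=
  (exists_injectiveHull R L).choose_spec

/-- `E_R`, the direct sum over all maximal ideals `m` of the injective hulls `E_R(R/m)`. -/
abbrev MatlisModule (R : Type u) [CommRing R] : Type u :=
  DirectSum (MaximalSpectrum R) fun m => injectiveHull R (R ⧸ m.asIdeal)

/-- The Matlis dual `Hom_R(L, E_R)`. -/
abbrev MatlisDual (R L : Type u) [CommRing R] [AddCommGroup L] [Module R L] : Type u :=
  L →ₗ[R] MatlisModule R

/-- The natural biduality map `l ↦ (ψ ↦ ψ l)`. -/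
noncomputable def matlisBidual (R L : Type u) [CommRing R] [AddCommGroup L] [Module R L] :
    L →ₗ[R] MatlisDual R (MatlisDual R L) :=
  LinearMap.applyₗ

/-- A module is Matlis reflexive if its natural biduality map is an isomorphism. -/
def IsMatlisReflexive (R L : Type u) [CommRing R] [AddCommGroup L] [Module R L] : Prop :=
  Function.Bijective (matlisBidual R L)

/-- The `R`-module `Tor_i^R(M, M')`. -/
noncomputable abbrev TorModule (R : Type u) [CommRing R] (i : ℕ) (M M' : Type u)
    [AddCommGroup M] [Module R M] [AddCommGroup M'] [Module R M'] : ModuleCat.{u} R :=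
  ((CategoryTheory.Tor (ModuleCat.{u} R) i).obj (ModuleCat.of R M)).obj (ModuleCat.of R M')

end MatlisTor

/-! Assertion (1) is the main point. The ideal Ann(M) + Ann(M') kills Tor, and a mini-max module
killed by an ideal I has finite length if R/I is artinian and is Matlis reflexive if R/I is
semi-local and complete.

Mini-max modules are closed under submodules, quotients and extensions, so for (1) M may be taken
noetherian or artinian. For M noetherian, dimension shifting along free covers leads down to a
quotient of a finite power of M' (`isMinimax_tor_of_isNoetherian`). For M artinian, Tor is even
artinian (`isArtinian_tor`): M is torsion for an ideal with artinian quotient ring, and one inducts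
on its generators (`isArtinian_tor_of_torsion`). For a generator x, the chain of the x^n M stops at
some B with xB = B. On M/B and on K = ker(x : B → B) the element x is nilpotent, so the induction
covers both. The x-torsion of Tor(B, M') is a quotient of Tor(K, M'), and an x-power-torsion module
with artinian x-torsion is artinian (`isArtinian_of_isArtinian_torsionBy`).

For (2), E_R is an injective cogenerator, so reflexive modules are closed under submodules,
quotients, extensions and duals. By completeness R/I is reflexive (`isMatlisReflexive_quotient`).
Noetherian modules killed by I are quotients of powers of R/I, artinian ones embed in powers of its
dual. -/

namespace MatlisTor

/-! ### Closure properties of mini-max modules -/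

section Minimax

variable {R L L₁ L₂ : Type*} [CommRing R] [AddCommGroup L] [Module R L]
  [AddCommGroup L₁] [Module R L₁] [AddCommGroup L₂] [Module R L₂]

theorem IsMinimax.of_isNoetherian [IsNoetherian R L] : IsMinimax R L :=
  ⟨⊤, inferInstance, inferInstance⟩

theorem IsMinimax.of_isArtinian [IsArtinian R L] : IsMinimax R L :=
  ⟨⊥, inferInstance, inferInstance⟩

theorem IsMinimax.of_injective (h : IsMinimax R L) (f : L₁ →ₗ[R] L)
    (hf : Function.Injective f) : IsMinimax R L₁ := by
  obtain ⟨N, hN, hA⟩ := h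
  refine ⟨N.comap f, ?_, ?_⟩
  · exact isNoetherian_of_injective (f.restrict (p := N.comap f) (q := N) fun x hx => hx)
      fun x y hxy => Subtype.ext (hf (congrArg Subtype.val hxy))
  · refine isArtinian_of_injective ((N.comap f).mapQ N f le_rfl) ?_
    rw [← LinearMap.ker_eq_bot, Submodule.ker_mapQ, ← Submodule.mkQ_map_self]

theorem IsMinimax.of_surjective (h : IsMinimax R L) (f : L →ₗ[R] L₁)
    (hf : Function.Surjective f) : IsMinimax R L₁ := by
  obtain ⟨N, hN, hA⟩ := h
  refine ⟨N.map f, ?_, ?_⟩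
  · infer_instance
  · refine isArtinian_of_surjective _ (N.mapQ (N.map f) f (Submodule.le_comap_map f N)) ?_
    rw [← LinearMap.range_eq_top, Submodule.range_mapQ, LinearMap.range_eq_top.2 hf,
      Submodule.map_top, Submodule.range_mkQ]

/-- In an exact sequence `L₁ → L → L₂` over a noetherian ring, `L` is mini-max if `L₁` and `L₂`
are. -/
theorem IsMinimax.of_exact [IsNoetherianRing R] (h₁ : IsMinimax R L₁) (h₂ : IsMinimax R L₂)
    (f : L₁ →ₗ[R] L) (g : L →ₗ[R] L₂) (hfg : Function.Exact f g) : IsMinimax R L := by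
  obtain ⟨N₁, hN₁, hA₁⟩ := h₁
  obtain ⟨N₂, hN₂, hA₂⟩ := h₂.of_injective (LinearMap.range g).subtype Subtype.val_injective
  -- `F` is a finitely generated lift of `N₂`. The quotient of `L` by `f(N₁) + F` then sits between
  -- the artinian modules `L₁ ⧸ N₁` and `range g ⧸ N₂`.
  obtain ⟨F, hF, hFN⟩ : ∃ F : Submodule R L, F.FG ∧ F.map g.rangeRestrict = N₂ := by
    obtain ⟨s, hs, rfl⟩ := Submodule.fg_def.1 (isNoetherian_submodule.1 hN₂ N₂ le_rfl)
    refine ⟨Submodule.span R (Function.surjInv g.surjective_rangeRestrict '' s),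
      Submodule.fg_span (hs.image _), ?_⟩
    rw [Submodule.map_span, Set.image_image]
    simp [Function.surjInv_eq]
  have hFn : IsNoetherian R F := isNoetherian_of_fg_of_noetherian F hF
  have hfn : IsNoetherian R (N₁.map f) := inferInstance
  set N := N₁.map f ⊔ F with hN
  refine ⟨N, inferInstance, ?_⟩
  let α : (L₁ ⧸ N₁) →ₗ[R] L ⧸ N :=
    N₁.mapQ N f (Submodule.map_le_iff_le_comap.1 le_sup_left)
  have hgN : N.map g.rangeRestrict ≤ N₂ := by
    rw [Submodule.map_sup, hFN, sup_le_iff]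
    refine ⟨?_, le_rfl⟩
    rintro _ ⟨_, ⟨x, hx, rfl⟩, rfl⟩
    have : g.rangeRestrict (f x) = 0 := Subtype.ext (hfg.apply_apply_eq_zero x)
    rw [this]
    exact N₂.zero_mem
  let β : (L ⧸ N) →ₗ[R] LinearMap.range g ⧸ N₂ :=
    N.mapQ N₂ g.rangeRestrict (Submodule.map_le_iff_le_comap.1 hgN)
  refine isArtinian_of_range_eq_ker α β (le_antisymm ?_ ?_)
  · rintro _ ⟨x, rfl⟩
    obtain ⟨x, rfl⟩ := N₁.mkQ_surjective x
    have : g.rangeRestrict (f x) = 0 := Subtype.ext (hfg.apply_apply_eq_zero x)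
    simp only [LinearMap.mem_ker, α, β, Submodule.mkQ_apply, Submodule.mapQ_apply, this,
      Submodule.Quotient.mk_zero]
  · intro y hy
    obtain ⟨y, rfl⟩ := N.mkQ_surjective y
    have hy' : g.rangeRestrict y ∈ N₂ := by
      simpa [β, LinearMap.mem_ker, Submodule.mapQ_apply] using hy
    rw [← hFN] at hy'
    obtain ⟨z, hz, hzy⟩ := hy'
    obtain ⟨x, hx⟩ := (hfg (y - z)).1 (by
      rw [map_sub, sub_eq_zero]; exact (congrArg Subtype.val hzy).symm)
    refine ⟨N₁.mkQ x, ?_⟩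
    simp only [α, Submodule.mkQ_apply, Submodule.mapQ_apply, hx]
    rw [Submodule.Quotient.eq]
    simpa using N.neg_mem (le_sup_right (a := N₁.map f) hz)

theorem IsMinimax.pi {ι : Type*} [Finite ι] (h : IsMinimax R L) : IsMinimax R (ι → L) := by
  classical
  have := Fintype.ofFinite ι
  obtain ⟨N, hN, hA⟩ := h
  refine ⟨Submodule.pi Set.univ fun _ => N, ?_, ?_⟩
  · exact isNoetherian_of_injective
      (LinearMap.pi fun i => ((LinearMap.proj i : (ι → L) →ₗ[R] L).restrict
        (p := Submodule.pi Set.univ fun _ => N) (q := N) fun x hx => hx i trivial))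
      fun x y hxy => Subtype.ext (funext fun i => congrArg Subtype.val (congrFun hxy i))
  · exact isArtinian_of_linearEquiv (Submodule.quotientPi fun _ : ι => N).symm

end Minimax

/-! ### Modules killed by an ideal with artinian quotient ring -/

section ArtinianQuotient

variable {R : Type*} [CommRing R]

/-- A noetherian ring is artinian exactly when its Krull dimension is at most zero. In this form the
condition sees only the primes above `I`, so generators of `I` may be replaced by powers. -/
theorem isArtinianRing_quotient_iff [IsNoetherianRing R] {I : Ideal R} :
    IsArtinianRing (R ⧸ I) ↔ ∀ p : Ideal R, p.IsPrime → I ≤ p → p.IsMaximal := by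
  constructor
  · intro _ p hp hI
    have : (p.map (Ideal.Quotient.mk I)).IsPrime :=
      Ideal.map_isPrime_of_surjective Ideal.Quotient.mk_surjective (by rwa [Ideal.mk_ker])
    have hm := (IsArtinianRing.isPrime_iff_isMaximal _).1 this
    have := Ideal.comap_isMaximal_of_surjective (Ideal.Quotient.mk I)
      Ideal.Quotient.mk_surjective (K := p.map (Ideal.Quotient.mk I))
    rwa [Ideal.comap_map_of_surjective' _ Ideal.Quotient.mk_surjective, Ideal.mk_ker,
      sup_eq_left.2 hI] at this
  · intro h
    rw [isArtinianRing_iff_krullDimLE_zero, Ring.krullDimLE_zero_iff]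
    intro q hq
    have hmax := h (q.comap (Ideal.Quotient.mk I)) inferInstance
      (Ideal.mk_ker.symm.le.trans (Ideal.ker_le_comap _))
    exact Ideal.isMaximal_of_isIntegral_of_isMaximal_comap _ hmax

variable {L : Type*} [AddCommGroup L] [Module R L]

/-- Submodules over `R` and over `R ⧸ I` coincide, so this is Hopkins–Levitzki over `R ⧸ I`. -/
theorem isNoetherian_iff_isArtinian_of_le_annihilator {I : Ideal R} [IsArtinianRing (R ⧸ I)]
    (h : I ≤ Module.annihilator R L) : IsNoetherian R L ↔ IsArtinian R L := by
  have hI : Module.IsTorsionBySet R L I := fun x r => Module.mem_annihilator.1 (h r.2) x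
  let := hI.module
  have : IsScalarTower R (R ⧸ I) L := hI.isScalarTower
  rw [hI.semilinearMap.isArtinian_iff_of_bijective Function.bijective_id,
    ← IsSemiprimaryRing.isNoetherian_iff_isArtinian,
    hI.semilinearMap.isNoetherian_iff_of_bijective Function.bijective_id]

theorem IsMinimax.isFiniteLength {I : Ideal R} [IsArtinianRing (R ⧸ I)]
    (h : I ≤ Module.annihilator R L) (hL : IsMinimax R L) : IsFiniteLength R L := by
  obtain ⟨N, hN, hA⟩ := hL
  have h₁ : IsArtinian R N := (isNoetherian_iff_isArtinian_of_le_annihilator (I := I)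
    (h.trans (N.subtype.annihilator_le_of_injective Subtype.val_injective))).1 hN
  have h₂ : IsArtinian R L := (isArtinian_iff_submodule_quotient N).2 ⟨h₁, hA⟩
  exact isFiniteLength_iff_isNoetherian_isArtinian.2
    ⟨(isNoetherian_iff_isArtinian_of_le_annihilator h).2 h₂, h₂⟩

end ArtinianQuotient

/-! ### Torsion criteria for artinian modules -/

section Torsion

variable {R L : Type*} [CommRing R] [AddCommGroup L] [Module R L]

/-- If every element of `L` is killed by a power of `x` and the kernel of multiplication by `x`
is artinian, then `L` is artinian. -/
theorem isArtinian_of_isArtinian_torsionBy (x : R) (h : ∀ l : L, ∃ n : ℕ, x ^ n • l = 0)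
    [IsArtinian R (Submodule.torsionBy R L x)] : IsArtinian R L := by
  rw [← monotone_stabilizes_iff_artinian]
  intro N
  -- `a k j` is the intersection of x^j N_k with the x-torsion. It decreases in both indices, so it
  -- becomes constant in `k` uniformly in `j`: a minimal member handles all large `j`, and finitely
  -- many `j` remain.
  let a (k j : ℕ) : Submodule R (Submodule.torsionBy R L x) :=
    Submodule.comap (Submodule.torsionBy R L x).subtype
      (Submodule.map (LinearMap.lsmul R L (x ^ j)) (OrderDual.ofDual (N k)))
  have ha₁ {k k' : ℕ} (j : ℕ) (hk : k ≤ k') : a k' j ≤ a k j := by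
    rintro s ⟨y, hy, hs⟩
    exact ⟨y, N.monotone hk hy, hs⟩
  have ha₂ (k : ℕ) {j j' : ℕ} (hj : j ≤ j') : a k j' ≤ a k j := by
    rintro s ⟨y, hy, hs⟩
    refine ⟨x ^ (j' - j) • y, Submodule.smul_mem _ _ hy, ?_⟩
    rw [← hs]
    simp [smul_smul, ← pow_add, Nat.sub_add_cancel hj]
  obtain ⟨_, ⟨⟨k₀, j₀⟩, rfl⟩, hmin⟩ := IsArtinian.set_has_minimal
    (Set.range fun p : ℕ × ℕ => a p.1 p.2) ⟨_, ⟨(0, 0), rfl⟩⟩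
  have hbig {k j : ℕ} (hk : k₀ ≤ k) (hj : j₀ ≤ j) : a k j = a k₀ j₀ :=
    eq_of_le_of_not_lt ((ha₁ j hk).trans (ha₂ k₀ hj)) (hmin _ ⟨(k, j), rfl⟩)
  have hstab (j : ℕ) : ∃ n, ∀ m, n ≤ m → a n j = a m j :=
    IsArtinian.monotone_stabilizes (R := R) ⟨fun k => OrderDual.toDual (a k j), fun k k' hk => ha₁ j hk⟩
  choose n hn using hstab
  refine ⟨max k₀ ((Finset.range j₀).sup n), fun m hm => ?_⟩
  set K := max k₀ ((Finset.range j₀).sup n) with hK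
  have key (j : ℕ) : a K j = a m j := by
    by_cases hj : j₀ ≤ j
    · rw [hbig (le_max_left _ _) hj, hbig ((le_max_left _ _).trans hm) hj]
    · have hnj : n j ≤ K :=
        (Finset.le_sup (f := n) (Finset.mem_range.2 (not_le.1 hj))).trans (le_max_right _ _)
      rw [← hn j K hnj, ← hn j m (hnj.trans hm)]
  -- If x^(j+1) y = 0, then x^j y lies in `a K j = a m j`, so x^j y = x^j z with z in `N m`, and y -
  -- z is killed by x^j.
  have hpow (j : ℕ) : ∀ y ∈ OrderDual.ofDual (N K), x ^ j • y = 0 → y ∈ OrderDual.ofDual (N m) := by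
    induction j with
    | zero => intro y _ hy; rw [pow_zero, one_smul] at hy; rw [hy]; exact Submodule.zero_mem _
    | succ j ih =>
      intro y hy hxy
      have hs : (⟨x ^ j • y, by
          rw [Submodule.mem_torsionBy_iff, smul_smul, ← pow_succ', hxy]⟩ :
          Submodule.torsionBy R L x) ∈ a K j := ⟨y, hy, rfl⟩
      rw [key j] at hs
      obtain ⟨z, hz, hzy⟩ := hs
      have := ih (y - z) (Submodule.sub_mem _ hy (N.monotone hm hz)) (by
        rw [smul_sub, sub_eq_zero]; exact hzy.symm)
      simpa using Submodule.add_mem _ this hz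
  refine le_antisymm (N.monotone hm) ?_
  intro y hy
  obtain ⟨j, hj⟩ := h y
  exact hpow j y hy hj

variable [IsNoetherianRing R]

/-- If `I` is contained in every minimal prime over the annihilator of `l`, it being enough to
consider primes which are themselves annihilators of elements, then a power of `I` kills `l`. -/
theorem exists_pow_smul_eq_zero {I : Ideal R} (l : L)
    (h : ∀ (p : Ideal R) (y : L), p ∈ (Ideal.torsionOf R L l).minimalPrimes →
      p = Ideal.torsionOf R L y → I ≤ p) : ∃ n : ℕ, ∀ r ∈ I ^ n, r • l = 0 := by
  have hcolon (y : L) : (⊥ : Submodule R L).colon {y} = Ideal.torsionOf R L y := by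
    ext r; simp [Submodule.mem_colon_singleton]
  obtain ⟨n, hn⟩ := Ideal.exists_pow_le_of_le_radical_of_fg (I := I)
    (J := Ideal.torsionOf R L l) (by
      rw [← Ideal.sInf_minimalPrimes]
      refine le_sInf fun p hp => ?_
      obtain ⟨y, hy⟩ := Submodule.exists_eq_colon_of_mem_minimalPrimes
        (N := (⊥ : Submodule R L)) (x := l) (I := p) (by rwa [hcolon])
      exact h p y hp (hy.trans (hcolon y))) (IsNoetherian.noetherian I)
  exact ⟨n, fun r hr => hn hr⟩

/-- Over a noetherian ring, an artinian module is torsion with respect to an ideal with artinian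
quotient ring. -/
theorem exists_isArtinianRing_quotient_torsion [IsArtinian R L] :
    ∃ I : Ideal R, IsArtinianRing (R ⧸ I) ∧ ∀ l : L, ∃ n : ℕ, ∀ r ∈ I ^ n, r • l = 0 := by
  -- The m-torsion parts for distinct maximal ideals m are independent, so only finitely many are
  -- nonzero. The ideal sought is the intersection of the corresponding m.
  have hind : iSupIndep fun m : MaximalSpectrum R => Submodule.torsionBySet R L m.asIdeal := by
    rw [iSupIndep_iff_supIndep]
    exact fun _ => Submodule.supIndep_torsionBySet_ideal fun m _ m' _ hmm' =>
      Ideal.IsMaximal.coprime_of_ne m.isMaximal m'.isMaximal fun h => hmm' (MaximalSpectrum.ext h)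
  have hfin := WellFoundedLT.finite_ne_bot_of_iSupIndep hind
  refine ⟨hfin.toFinset.inf MaximalSpectrum.asIdeal, ?_, fun l => ?_⟩
  · rw [isArtinianRing_quotient_iff]
    intro p hp hle
    obtain ⟨m, -, hm⟩ := (hp.inf_le' ).1 hle
    rw [← m.isMaximal.eq_of_le hp.ne_top hm]
    exact m.isMaximal
  · refine exists_pow_smul_eq_zero l fun p y hp hy => ?_
    -- R/Ann(l) is isomorphic to the artinian module Rl, so `p` is maximal; as `p` kills `y ≠ 0`, it
    -- is one of the finitely many chosen ideals.
    have hart : IsArtinianRing (R ⧸ Ideal.torsionOf R L l) := by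
      have := isArtinian_of_linearEquiv (Ideal.quotTorsionOfEquivSpanSingleton R L l).symm
      exact isArtinian_of_tower R this
    have hpm : p.IsMaximal := isArtinianRing_quotient_iff.1 hart p hp.1.1 hp.1.2
    refine Finset.inf_le (f := MaximalSpectrum.asIdeal) (b := ⟨p, hpm⟩) ?_
    rw [Set.Finite.mem_toFinset, Set.mem_ofPred_eq, Submodule.ne_bot_iff]
    refine ⟨y, ?_, ?_⟩
    · rw [Submodule.mem_torsionBySet_iff]
      rintro ⟨r, hr⟩
      exact (hy ▸ hr : r ∈ Ideal.torsionOf R L y)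
    · rintro rfl
      rw [Ideal.torsionOf_zero] at hy
      exact hpm.ne_top hy

end Torsion

/-! ### Exactness, linearity and annihilators of Tor -/

section Tor

open CategoryTheory MonoidalCategory

variable {R : Type u} [CommRing R]

/-- The complex `A ⊗ P`. -/
noncomputable abbrev tensorComplex (A : ModuleCat.{u} R) (P : ChainComplex (ModuleCat.{u} R) ℕ) :
    ChainComplex (ModuleCat.{u} R) ℕ :=
  (((tensoringLeft (ModuleCat.{u} R)).obj A).mapHomologicalComplex _).obj P

/-- The map of complexes `A ⊗ P ⟶ B ⊗ P` induced by a map `A ⟶ B`. -/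
noncomputable abbrev tensorComplexMap {A B : ModuleCat.{u} R} (f : A ⟶ B)
    (P : ChainComplex (ModuleCat.{u} R) ℕ) : tensorComplex A P ⟶ tensorComplex B P :=
  (NatTrans.mapHomologicalComplex ((tensoringLeft (ModuleCat.{u} R)).map f) _).app P

theorem tensorComplexMap_comp {A B C : ModuleCat.{u} R} (f : A ⟶ B) (g : B ⟶ C)
    (P : ChainComplex (ModuleCat.{u} R) ℕ) :
    tensorComplexMap (f ≫ g) P = tensorComplexMap f P ≫ tensorComplexMap g P := by
  ext i : 1
  exact MonoidalCategory.comp_whiskerRight f g (P.X i)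

/-- The short complex of complexes obtained by tensoring a short complex of modules. -/
noncomputable abbrev tensorShortComplex (S : ShortComplex (ModuleCat.{u} R))
    (P : ChainComplex (ModuleCat.{u} R) ℕ) : ShortComplex (ChainComplex (ModuleCat.{u} R) ℕ) :=
  ShortComplex.mk (tensorComplexMap S.f P) (tensorComplexMap S.g P) (by
    rw [← tensorComplexMap_comp, S.zero]
    ext i : 1
    exact MonoidalPreadditive.zero_whiskerRight)

theorem tensorShortComplex_shortExact {S : ShortComplex (ModuleCat.{u} R)} (hS : S.ShortExact)
    (P : ChainComplex (ModuleCat.{u} R) ℕ) (hP : ∀ i, Module.Flat R (P.X i)) :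
    (tensorShortComplex S P).ShortExact := by
  refine HomologicalComplex.shortExact_of_degreewise_shortExact _ fun i => ?_
  have := hP i
  exact hS.map_of_exact (tensorRight (P.X i))

variable {M' : Type u} [AddCommGroup M'] [Module R M']

instance (P : ProjectiveResolution (ModuleCat.of R M')) (i : ℕ) : Module.Flat R (P.complex.X i) :=
  have := (IsProjective.iff_projective (R := R) (P.complex.X i)).2 (P.projective i)
  inferInstance

variable {A B C : Type u} [AddCommGroup A] [Module R A] [AddCommGroup B] [Module R B]
  [AddCommGroup C] [Module R C]

variable (M') in
/-- The map on `Tor` induced by a map in the first variable. -/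
noncomputable def torMap (i : ℕ) (f : A →ₗ[R] B) : TorModule R i A M' →ₗ[R] TorModule R i B M' :=
  (((Tor (ModuleCat.{u} R) i).map (ModuleCat.ofHom f)).app (ModuleCat.of R M')).hom

/-- `Tor` computed by a projective resolution. -/
noncomputable def torEquiv (P : ProjectiveResolution (ModuleCat.of R M')) (A : Type u)
    [AddCommGroup A] [Module R A] (i : ℕ) :
    TorModule R i A M' ≃ₗ[R] (tensorComplex (ModuleCat.of R A) P.complex).homology i :=
  (P.isoLeftDerivedObj ((tensoringLeft (ModuleCat.{u} R)).obj (ModuleCat.of R A)) i).toLinearEquiv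

theorem torEquiv_torMap (P : ProjectiveResolution (ModuleCat.of R M')) (i : ℕ) (f : A →ₗ[R] B)
    (x : TorModule R i A M') :
    torEquiv P B i (torMap M' i f x) = (HomologicalComplex.homologyMap
      (tensorComplexMap (ModuleCat.ofHom f) P.complex) i).hom (torEquiv P A i x) := by
  have := ProjectiveResolution.leftDerived_app_eq
    ((tensoringLeft (ModuleCat.{u} R)).map (ModuleCat.ofHom f)) P i
  have h2 := (Iso.comp_inv_eq _).1 (this.trans (Category.assoc _ _ _).symm).symm
  exact (congrArg (fun φ => φ.hom x) h2).symm

theorem shortExact_of_linearMap {f : A →ₗ[R] B} {g : B →ₗ[R] C} (hf : Function.Injective f)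
    (hfg : Function.Exact f g) (hg : Function.Surjective g) :
    (ShortComplex.mk (ModuleCat.ofHom f) (ModuleCat.ofHom g)
      (ModuleCat.hom_ext hfg.linearMap_comp_eq_zero)).ShortExact where
  exact := (ShortComplex.ShortExact.moduleCat_exact_iff_function_exact _).2 hfg
  mono_f := (ModuleCat.mono_iff_injective _).2 hf
  epi_g := (ModuleCat.epi_iff_surjective _).2 hg

variable (M') in
theorem torMap_exact {f : A →ₗ[R] B} {g : B →ₗ[R] C} (hf : Function.Injective f)
    (hfg : Function.Exact f g) (hg : Function.Surjective g) (i : ℕ) :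
    Function.Exact (torMap M' i f) (torMap M' i g) := by
  let P := ProjectiveResolution.of (ModuleCat.of R M')
  have h := (ShortComplex.ShortExact.moduleCat_exact_iff_function_exact _).1
    ((tensorShortComplex_shortExact (shortExact_of_linearMap hf hfg hg) P.complex
    inferInstance).homology_exact₂ i)
  intro y
  rw [← (torEquiv P C i).map_eq_zero_iff, torEquiv_torMap]
  refine (h _).trans ⟨?_, ?_⟩
  · rintro ⟨x, hx⟩
    obtain ⟨x, rfl⟩ := (torEquiv P A i).surjective x
    exact ⟨x, (torEquiv P B i).injective ((torEquiv_torMap P i f x).trans hx)⟩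
  · rintro ⟨x, rfl⟩
    exact ⟨torEquiv P A i x, (torEquiv_torMap P i f x).symm⟩

variable (M') in
theorem subsingleton_tor_of_flat [Module.Flat R A] (i : ℕ) :
    Subsingleton (TorModule R (i + 1) A M') := by
  let P := ProjectiveResolution.of (ModuleCat.of R M')
  have h : (tensorComplex (ModuleCat.of R A) P.complex).ExactAt (i + 1) := by
    refine (HomologicalComplex.exactAt_iff' _ (i + 2) (i + 1) i (by simp) (by simp)).2 ?_
    have := Module.Flat.lTensor_shortComplex_exact (ModuleCat.of R A) _ (P.exact_succ i)
    exact this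
  have := ModuleCat.subsingleton_of_isZero h.isZero_homology
  exact (torEquiv P A (i + 1)).injective.subsingleton

variable (M') in
/-- Dimension shifting in the first variable. -/
theorem exists_injective_tor [Module.Flat R B] {f : A →ₗ[R] B} {g : B →ₗ[R] C}
    (hf : Function.Injective f) (hfg : Function.Exact f g) (hg : Function.Surjective g) (i : ℕ) :
    ∃ δ : TorModule R (i + 1) C M' →ₗ[R] TorModule R i A M', Function.Injective δ := by
  let P := ProjectiveResolution.of (ModuleCat.of R M')
  have hS := tensorShortComplex_shortExact (shortExact_of_linearMap hf hfg hg) P.complex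
    inferInstance
  have h := (ShortComplex.ShortExact.moduleCat_exact_iff_function_exact _).1
    (hS.homology_exact₃ (i + 1) i (by simp))
  have := subsingleton_tor_of_flat (R := R) (A := B) M' i
  have hs := (torEquiv P B (i + 1)).symm.injective.subsingleton
  let d := (hS.δ (i + 1) i (by simp)).hom
  have hinj : Function.Injective d := by
    rw [injective_iff_map_eq_zero]
    intro x hx
    obtain ⟨y, hy⟩ := (h x).1 hx
    rw [← hy, Subsingleton.elim (h := hs) y 0]
    exact map_zero _
  exact ⟨(torEquiv P A i).symm.toLinearMap ∘ₗ d ∘ₗ (torEquiv P C (i + 1)).toLinearMap,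
    (torEquiv P A i).symm.injective.comp (hinj.comp (torEquiv P C (i + 1)).injective)⟩

variable (A M') in
/-- `Tor₀` is the tensor product. -/
noncomputable def torZeroEquiv : TorModule R 0 A M' ≃ₗ[R] TensorProduct R A M' :=
  (((tensorLeft (ModuleCat.of R A)).leftDerivedZeroIsoSelf).app (ModuleCat.of R M')).toLinearEquiv

theorem homologyMap_smul {K L : ChainComplex (ModuleCat.{u} R) ℕ} (r : R) (f : K ⟶ L) (i : ℕ) :
    HomologicalComplex.homologyMap (r • f) i = r • HomologicalComplex.homologyMap f i :=
  ShortComplex.homologyMap_smul ((HomologicalComplex.shortComplexFunctor _ _ i).map f) r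

/-- This turns exact sequences built on multiplication by `r` on `A` into statements about the
`r`-torsion of Tor. -/
theorem torMap_smul_id (i : ℕ) (r : R) (x : TorModule R i A M') :
    torMap M' i (r • LinearMap.id : A →ₗ[R] A) x = r • x := by
  let P := ProjectiveResolution.of (ModuleCat.of R M')
  apply (torEquiv P A i).injective
  have h : tensorComplexMap (ModuleCat.ofHom (r • LinearMap.id : A →ₗ[R] A)) P.complex =
      r • 𝟙 _ := by
    ext i : 1
    exact (MonoidalLinear.smul_whiskerRight r (𝟙 (ModuleCat.of R A)) (P.complex.X i)).trans
      (congrArg (r • ·) (id_whiskerRight _ _))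
  rw [torEquiv_torMap, h, homologyMap_smul, HomologicalComplex.homologyMap_id, map_smul]
  rfl

/-- If every element of `A` is killed by a power of `r`, then so is every element of
`Tor`. -/
theorem exists_pow_smul_tor_eq_zero (r : R) (h : ∀ a : A, ∃ n : ℕ, r ^ n • a = 0) (i : ℕ)
    (x : TorModule R i A M') : ∃ n : ℕ, r ^ n • x = 0 := by
  let P := ProjectiveResolution.of (ModuleCat.of R M')
  let K := tensorComplex (ModuleCat.of R A) P.complex
  -- A class in Tor lifts to a cycle in A ⊗ P_i, and a tensor has only finitely many terms.
  obtain ⟨z, hz⟩ := (ModuleCat.epi_iff_surjective (K.homologyπ i)).1 inferInstance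
    (torEquiv P A i x)
  have ht (t : TensorProduct R A (P.complex.X i)) : ∃ n : ℕ, r ^ n • t = 0 := by
    induction t with
    | zero => exact ⟨0, smul_zero _⟩
    | tmul a p =>
      obtain ⟨n, hn⟩ := h a
      exact ⟨n, by rw [TensorProduct.smul_tmul', hn, TensorProduct.zero_tmul]⟩
    | add s t hs ht =>
      obtain ⟨n, hn⟩ := hs
      obtain ⟨m, hm⟩ := ht
      refine ⟨n + m, ?_⟩
      rw [smul_add, pow_add, mul_smul _ _ t, hm, smul_zero, mul_comm, mul_smul, hn, smul_zero,
        add_zero]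
  obtain ⟨n, hn⟩ := ht ((K.iCycles i).hom z)
  refine ⟨n, (torEquiv P A i).injective ?_⟩
  have hz0 : r ^ n • z = 0 := (ModuleCat.mono_iff_injective (K.iCycles i)).1 inferInstance
    (by rw [map_zero]; exact (map_smul (K.iCycles i).hom _ _).trans hn)
  rw [map_smul, map_zero, ← hz]
  exact (map_smul (K.homologyπ i).hom _ _).symm.trans (by rw [hz0]; exact map_zero _)

theorem annihilator_le_annihilator_tor_left (i : ℕ) :
    Module.annihilator R A ≤ Module.annihilator R (TorModule R i A M') := by
  intro r hr
  rw [Module.mem_annihilator] at hr ⊢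
  intro x
  have h : (r • LinearMap.id : A →ₗ[R] A) = (0 : R) • LinearMap.id :=
    LinearMap.ext fun a => by simpa using hr a
  rw [← torMap_smul_id, h, torMap_smul_id, zero_smul]

/-- Multiplication by `r` on the resolution and the zero map both lift the zero endomorphism of
`M'`, so they agree on Tor. -/
theorem annihilator_le_annihilator_tor_right (i : ℕ) :
    Module.annihilator R M' ≤ Module.annihilator R (TorModule R i A M') := by
  intro r hr
  rw [Module.mem_annihilator] at hr ⊢
  intro x
  let P := ProjectiveResolution.of (ModuleCat.of R M')
  let F := (tensoringLeft (ModuleCat.{u} R)).obj (ModuleCat.of R A)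
  have h₁ := P.isoLeftDerivedObj_hom_naturality (0 : ModuleCat.of R M' ⟶ ModuleCat.of R M') P
    (0 : P.complex ⟶ P.complex) (Limits.zero_comp.trans Limits.comp_zero.symm) F i
  have h₂ := P.isoLeftDerivedObj_hom_naturality (0 : ModuleCat.of R M' ⟶ ModuleCat.of R M') P
    (r • 𝟙 P.complex : P.complex ⟶ P.complex) (by
      ext y
      exact (map_smul (P.π.f 0).hom r y).trans (hr _)) F i
  have h₃ : (F.mapHomologicalComplex (ComplexShape.down ℕ)).map (r • 𝟙 P.complex) = r • 𝟙 _ := by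
    ext j : 1
    exact (MonoidalLinear.whiskerLeft_smul (ModuleCat.of R A) r (𝟙 (P.complex.X j))).trans
      (congrArg (r • ·) (whiskerLeft_id _ _))
  have h₄ := congrArg (fun φ => φ.hom x) (h₁.symm.trans h₂)
  have h₅ : HomologicalComplex.homologyMap
      ((F.mapHomologicalComplex (ComplexShape.down ℕ)).map (r • 𝟙 P.complex)) i = r • 𝟙 _ := by
    rw [h₃, homologyMap_smul, HomologicalComplex.homologyMap_id]
  have h₆ : HomologicalComplex.homologyMap
      ((F.mapHomologicalComplex (ComplexShape.down ℕ)).map (0 : P.complex ⟶ P.complex)) i = 0 := by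
    rw [Functor.map_zero, HomologicalComplex.homologyMap_zero]
  have h₇ : (0 : (tensorComplex (ModuleCat.of R A) P.complex).homology i) =
      r • torEquiv P A i x :=
    (congrArg (fun φ => φ.hom (torEquiv P A i x)) h₆).symm.trans
      (h₄.trans (congrArg (fun φ => φ.hom (torEquiv P A i x)) h₅))
  apply (torEquiv P A i).injective
  rw [map_smul, map_zero, ← h₇]

end Tor

/-! ### Tor of mini-max modules -/

section TorMinimax

variable {R : Type u} [CommRing R] [IsNoetherianRing R]
  {M' : Type u} [AddCommGroup M'] [Module R M']

/-- `Tor` of a finitely generated module and a mini-max module is mini-max. -/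
theorem isMinimax_tor_of_isNoetherian (hM' : IsMinimax R M') (i : ℕ) (A : Type u) [AddCommGroup A]
    [Module R A] [IsNoetherian R A] : IsMinimax R (TorModule R i A M') := by
  induction i generalizing A with
  | zero =>
    obtain ⟨n, f, hf⟩ := Module.Finite.exists_fin' R A
    have h : IsMinimax R (TensorProduct R (Fin n → R) M') :=
      hM'.pi.of_injective ((TensorProduct.comm R (Fin n → R) M').trans
        (TensorProduct.piScalarRight R R M' (Fin n))).toLinearMap (LinearEquiv.injective _)
    have h' := h.of_surjective (f.rTensor M') (LinearMap.rTensor_surjective M' hf)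
    have e := torZeroEquiv (R := R) M' A
    exact h'.of_injective e.toLinearMap e.injective
  | succ i ih =>
    obtain ⟨n, f, hf⟩ := Module.Finite.exists_fin' R A
    obtain ⟨δ, hδ⟩ := exists_injective_tor (R := R) M' (f := (LinearMap.ker f).subtype) (g := f)
      Subtype.val_injective (LinearMap.exact_subtype_ker_map f) hf i
    exact (ih (LinearMap.ker f)).of_injective δ hδ

theorem isArtinian_tor_of_isArtinianRing_quotient (hM' : IsMinimax R M') (i : ℕ) {A : Type u}
    [AddCommGroup A] [Module R A] [IsArtinian R A] {I : Ideal R} [IsArtinianRing (R ⧸ I)]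
    (hI : I ≤ Module.annihilator R A) : IsArtinian R (TorModule R i A M') := by
  have := (isNoetherian_iff_isArtinian_of_le_annihilator hI).2 ‹_›
  exact (isFiniteLength_iff_isNoetherian_isArtinian.1 ((isMinimax_tor_of_isNoetherian hM' i
    A).isFiniteLength (hI.trans (annihilator_le_annihilator_tor_left i)))).2

/-- The inductive step on generators: `A` is killed by `I`, it is torsion with respect to each
element of `t`, and `I` and `t` together generate an ideal with artinian quotient ring. -/
theorem isArtinian_tor_of_torsion (hM' : IsMinimax R M') (i : ℕ) (t : Finset R) {A : Type u}
    [AddCommGroup A] [Module R A] [IsArtinian R A] (I : Ideal R) (hI : I ≤ Module.annihilator R A)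
    (hIt : IsArtinianRing (R ⧸ (I ⊔ Ideal.span (t : Set R))))
    (ht : ∀ x ∈ t, ∀ a : A, ∃ n : ℕ, x ^ n • a = 0) :
    IsArtinian R (TorModule R i A M') := by
  classical
  induction t using Finset.induction_on generalizing I A with
  | empty =>
    rw [Finset.coe_empty, Ideal.span_empty, sup_bot_eq] at hIt
    exact isArtinian_tor_of_isArtinianRing_quotient hM' i hI
  | insert x t _ ih =>
    -- A prime contains x^k only if it contains x, so moving x^k into the annihilating ideal keeps
    -- the quotient artinian.
    have hpow (k : ℕ) :
        IsArtinianRing (R ⧸ (I ⊔ Ideal.span {x ^ k} ⊔ Ideal.span (t : Set R))) := by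
      rw [isArtinianRing_quotient_iff] at hIt ⊢
      intro p hp hle
      rw [sup_le_iff, sup_le_iff, Ideal.span_singleton_le_iff_mem] at hle
      refine hIt p hp ?_
      rw [Finset.coe_insert, Ideal.span_insert, sup_le_iff, sup_le_iff,
        Ideal.span_singleton_le_iff_mem]
      exact ⟨hle.1.1, hp.mem_of_pow_mem k hle.1.2, hle.2⟩
    obtain ⟨n, hn⟩ := IsArtinian.range_smul_pow_stabilizes A x
    let B : Submodule R A := LinearMap.range (x ^ n • LinearMap.id : A →ₗ[R] A)
    have hsurj : Function.Surjective (x • LinearMap.id : B →ₗ[R] B) := by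
      rintro ⟨b, hb⟩
      have hb' := hb
      simp only [B] at hb'
      rw [hn (n + 1) n.le_succ] at hb'
      obtain ⟨a, ha⟩ := hb'
      refine ⟨⟨x ^ n • a, ⟨a, rfl⟩⟩, Subtype.ext ?_⟩
      refine Eq.trans ?_ ha
      simp [smul_smul, pow_succ']
    have hquot : IsArtinian R (TorModule R i (A ⧸ B) M') := by
      refine ih (I ⊔ Ideal.span {x ^ n}) ?_ (hpow n) fun y hy a => ?_
      · refine sup_le (hI.trans (LinearMap.annihilator_le_of_surjective _ B.mkQ_surjective)) ?_
        rw [Ideal.span_singleton_le_iff_mem, Module.mem_annihilator]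
        intro a
        obtain ⟨a, rfl⟩ := B.mkQ_surjective a
        rw [← map_smul, Submodule.mkQ_apply, Submodule.Quotient.mk_eq_zero]
        exact ⟨a, rfl⟩
      · obtain ⟨a, rfl⟩ := B.mkQ_surjective a
        obtain ⟨k, hk⟩ := ht y (Finset.mem_insert_of_mem hy) a
        exact ⟨k, by rw [← map_smul, hk, map_zero]⟩
    let K := LinearMap.ker (x • LinearMap.id : B →ₗ[R] B)
    have hker : IsArtinian R (TorModule R i K M') := by
      refine ih (I ⊔ Ideal.span {x ^ 1}) ?_ (hpow 1) fun y hy a => ?_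
      · refine sup_le (hI.trans (LinearMap.annihilator_le_of_injective (B.subtype ∘ₗ K.subtype)
          (Subtype.val_injective.comp Subtype.val_injective))) ?_
        rw [Ideal.span_singleton_le_iff_mem, Module.mem_annihilator, pow_one]
        exact fun a => Subtype.ext a.2
      · obtain ⟨k, hk⟩ := ht y (Finset.mem_insert_of_mem hy) a
        exact ⟨k, Subtype.ext (Subtype.ext hk)⟩
    have hB : IsArtinian R (TorModule R i B M') := by
      have hexact := torMap_exact M' (f := K.subtype) Subtype.val_injective
        (LinearMap.exact_subtype_ker_map (x • LinearMap.id : B →ₗ[R] B)) hsurj i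
      -- Exactness of Tor(K) → Tor(B) → Tor(B), where the second map is multiplication by x.
      have hrange : Submodule.torsionBy R (TorModule R i B M') x =
          LinearMap.range (torMap M' i K.subtype) := by
        ext y
        rw [Submodule.mem_torsionBy_iff, ← torMap_smul_id]
        exact hexact y
      have : IsArtinian R (Submodule.torsionBy R (TorModule R i B M') x) := by
        rw [hrange]; infer_instance
      refine isArtinian_of_isArtinian_torsionBy x (exists_pow_smul_tor_eq_zero x (fun b => ?_) i)
      obtain ⟨k, hk⟩ := ht x (Finset.mem_insert_self x t) b
      exact ⟨k, Subtype.ext hk⟩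
    refine isArtinian_of_range_eq_ker (torMap M' i B.subtype) (torMap M' i B.mkQ) ?_
    exact (LinearMap.exact_iff.1 (torMap_exact M' (f := B.subtype) Subtype.val_injective
      (LinearMap.exact_subtype_mkQ B) B.mkQ_surjective i)).symm

/-- `Tor` of an artinian module and a mini-max module is artinian. -/
theorem isArtinian_tor (hM' : IsMinimax R M') (i : ℕ) (A : Type u) [AddCommGroup A]
    [Module R A] [IsArtinian R A] : IsArtinian R (TorModule R i A M') := by
  obtain ⟨I, hI, htors⟩ := exists_isArtinianRing_quotient_torsion (R := R) (L := A)
  obtain ⟨t, rfl⟩ := IsNoetherian.noetherian I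
  refine isArtinian_tor_of_torsion hM' i t ⊥ bot_le (by rwa [bot_sup_eq]) fun x hx a => ?_
  obtain ⟨n, hn⟩ := htors a
  exact ⟨n, hn _ (Ideal.pow_mem_pow (Submodule.subset_span hx) n)⟩

theorem isMinimax_tor {M : Type u} [AddCommGroup M] [Module R M] (hM : IsMinimax R M)
    (hM' : IsMinimax R M') (i : ℕ) : IsMinimax R (TorModule R i M M') := by
  obtain ⟨N, hN, hA⟩ := hM
  have := isArtinian_tor hM' i (M ⧸ N)
  exact (isMinimax_tor_of_isNoetherian hM' i N).of_exact IsMinimax.of_isArtinian _ _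
    (torMap_exact M' (f := N.subtype) Subtype.val_injective
      (LinearMap.exact_subtype_mkQ N) N.mkQ_surjective i)

end TorMinimax

/-! ### Injective hulls of residue fields -/

section Hull

variable {R : Type u} [CommRing R]

/-- Every element of an injective hull of `R / m` is killed by a power of `m`. -/
theorem IsInjectiveHull.exists_pow_smul_eq_zero [IsNoetherianRing R] {m : Ideal R} {E : Type u} [AddCommGroup E]
    [Module R E] {f : R ⧸ m →ₗ[R] E} (hf : IsInjectiveHull f) (e : E) :
    ∃ n : ℕ, ∀ r ∈ m ^ n, r • e = 0 := by
  refine MatlisTor.exists_pow_smul_eq_zero e fun p y hp hy s hs => ?_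
  have hp' : p.IsPrime := hp.1.1
  have hy0 : y ≠ 0 := by
    rintro rfl
    exact hp'.ne_top (hy.trans (Ideal.torsionOf_zero R E))
  -- By essentiality some r y is a nonzero element of the image of R/m. Then s in m kills r y, so s
  -- r lies in the prime p = Ann(y) while r does not.
  have hne : Submodule.span R {y} ⊓ LinearMap.range f ≠ ⊥ := fun h => hy0 (by
    simpa using hf.essential _ h)
  obtain ⟨z, ⟨hz, x, rfl⟩, hz0⟩ := Submodule.exists_mem_ne_zero_of_ne_bot hne
  obtain ⟨r, hr⟩ := Submodule.mem_span_singleton.1 hz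
  have hsx : s • x = 0 := by
    obtain ⟨x, rfl⟩ := Ideal.Quotient.mk_surjective x
    rw [← Ideal.Quotient.mk_eq_mk, ← Submodule.Quotient.mk_smul, Submodule.Quotient.mk_eq_zero]
    exact m.mul_mem_right _ hs
  have hsr : s * r ∈ p := by
    rw [hy, Ideal.mem_torsionOf_iff, mul_smul, hr, ← map_smul, hsx, map_zero]
  refine (hp'.mem_or_mem hsr).resolve_right fun h => hz0 ?_
  rw [hy, Ideal.mem_torsionOf_iff] at h
  rw [← hr, h]

/-- The elements of an injective hull of `R / m` that are killed by `m` form `R / m`. -/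
theorem IsInjectiveHull.mem_range {m : Ideal R} (hm : m.IsMaximal) {E : Type u} [AddCommGroup E]
    [Module R E] {f : R ⧸ m →ₗ[R] E} (hf : IsInjectiveHull f) {e : E}
    (he : ∀ r ∈ m, r • e = 0) : e ∈ LinearMap.range f := by
  by_cases he0 : e = 0
  · rw [he0]; exact zero_mem _
  have hne : Submodule.span R {e} ⊓ LinearMap.range f ≠ ⊥ := fun h => he0 (by
    simpa using hf.essential _ h)
  obtain ⟨z, ⟨hz, hzf⟩, hz0⟩ := Submodule.exists_mem_ne_zero_of_ne_bot hne
  obtain ⟨r, rfl⟩ := Submodule.mem_span_singleton.1 hz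
  have hr : r ∉ m := fun h => hz0 (he r h)
  obtain ⟨s, i, hi, hsi⟩ := hm.exists_inv hr
  have : s • r • e = e := by
    conv_rhs => rw [← one_smul R e, ← hsi, add_smul, he i hi, add_zero, mul_smul]
  rw [← this]
  exact Submodule.smul_mem _ _ hzf

end Hull

theorem IsMatlisReflexive.exists_forall {R L : Type u} [CommRing R]
    [AddCommGroup L] [Module R L] (h : IsMatlisReflexive R L)
    (ξ : MatlisDual R (MatlisDual R L)) : ∃ l : L, ∀ φ : MatlisDual R L, φ l = ξ φ :=
  (h.2 ξ).imp fun _ hl => LinearMap.congr_fun hl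

/-! ### The injective cogenerator E_R and closure properties of reflexive modules -/

section MatlisModule

variable (R : Type u) [CommRing R] [IsNoetherianRing R]

/-- A direct sum of injective modules over a noetherian ring is injective. -/
theorem injective_directSum {ι : Type u} (Q : ι → Type u) [∀ i, AddCommGroup (Q i)]
    [∀ i, Module R (Q i)] (hQ : ∀ i, Module.Injective R (Q i)) :
    Module.Injective R (DirectSum ι Q) := by
  classical
  refine Module.Baer.injective fun I g => ?_
  have hext (i : ι) := Module.Baer.of_injective (hQ i) I (DirectSum.component R ι Q i ∘ₗ g)
  choose h hh using hext
  obtain ⟨t, ht⟩ := (Module.Finite.fg_top : (⊤ : Submodule R I).FG)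
  -- `I` is finitely generated, so `g` takes values in finitely many summands, and the
  -- coordinatewise extensions assemble to an element `e` of the direct sum.
  let F : Finset ι := t.biUnion fun x => DFinsupp.support (g x)
  have hF (x : I) (i : ι) (hi : i ∉ F) : g x i = 0 := by
    have hx : x ∈ Submodule.span R (t : Set I) := ht ▸ Submodule.mem_top
    have hle : Submodule.span R (t : Set I) ≤ LinearMap.ker (DirectSum.component R ι Q i ∘ₗ g) := by
      rw [Submodule.span_le]
      intro y hy
      by_contra hne
      exact hi (Finset.mem_biUnion.2 ⟨y, hy, DFinsupp.mem_support_iff.2 hne⟩)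
    exact hle hx
  let e : DirectSum ι Q := DFinsupp.mk F fun i => h i 1
  refine ⟨LinearMap.toSpanSingleton R _ e, fun x hx => ?_⟩
  refine DFinsupp.ext fun i => ?_
  rw [LinearMap.toSpanSingleton_apply]
  refine (DFinsupp.smul_apply x e i).trans ?_
  by_cases hi : i ∈ F
  · have : e i = h i 1 := DFinsupp.mk_of_mem hi
    rw [this, ← map_smul, smul_eq_mul, mul_one, hh i x hx]
    rfl
  · have : e i = 0 := DFinsupp.mk_of_notMem hi
    rw [this, smul_zero]
    exact (hF ⟨x, hx⟩ i hi).symm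

theorem injective_matlisModule : Module.Injective R (MatlisModule R) :=
  injective_directSum R _ fun m =>
    (injectiveHull_spec R (R ⧸ m.asIdeal)).choose_spec.injective_module

variable {R} {L : Type u} [AddCommGroup L] [Module R L]

/-- The Matlis module is a cogenerator. -/
theorem exists_matlisDual_apply_ne_zero {l : L} (hl : l ≠ 0) : ∃ φ : MatlisDual R L, φ l ≠ 0 := by
  classical
  have hne : Ideal.torsionOf R L l ≠ ⊤ := by rwa [Ne, Ideal.torsionOf_eq_top_iff]
  obtain ⟨m, hm, hle⟩ := Ideal.exists_le_maximal _ hne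
  obtain ⟨f, hf⟩ := injectiveHull_spec R (R ⧸ m)
  have hinj := injective_matlisModule R
  let j : injectiveHull R (R ⧸ m) →ₗ[R] MatlisModule R :=
    DirectSum.lof R (MaximalSpectrum R) (fun m => injectiveHull R (R ⧸ m.asIdeal)) ⟨m, hm⟩
  have hj : Function.Injective j := DirectSum.of_injective (β := fun m : MaximalSpectrum R =>
    injectiveHull R (R ⧸ m.asIdeal)) ⟨m, hm⟩
  obtain ⟨φ, hφ⟩ := hinj.out (Submodule.span R {l}).subtype Subtype.val_injective
    -- The map Rl ≅ R/Ann(l) → R/m → E_R sends `l` to a nonzero element.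
    (j ∘ₗ f ∘ₗ Submodule.factor hle ∘ₗ (Ideal.quotTorsionOfEquivSpanSingleton R L l).symm.toLinearMap)
  refine ⟨φ, fun h => ?_⟩
  have h1 := hφ ⟨l, Submodule.mem_span_singleton_self l⟩
  have h2 : (Ideal.quotTorsionOfEquivSpanSingleton R L l).symm
      ⟨l, Submodule.mem_span_singleton_self l⟩ = Submodule.Quotient.mk 1 := by
    rw [LinearEquiv.symm_apply_eq]
    exact ((Ideal.quotTorsionOfEquivSpanSingleton_apply_mk l 1).trans (one_smul R _)).symm
  have h3 : j (f (Submodule.Quotient.mk 1)) = 0 := by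
    rw [← h]
    refine Eq.trans ?_ h1.symm
    simp only [LinearMap.comp_apply, LinearEquiv.coe_coe, h2]
    rfl
  rw [map_eq_zero_iff j hj, map_eq_zero_iff f hf.injective, Submodule.Quotient.mk_eq_zero] at h3
  exact hm.ne_top ((Ideal.eq_top_iff_one m).2 h3)

theorem matlisBidual_injective : Function.Injective (matlisBidual R L) := by
  rw [injective_iff_map_eq_zero]
  intro l hl
  by_contra hne
  obtain ⟨φ, hφ⟩ := exists_matlisDual_apply_ne_zero (R := R) hne
  exact hφ (LinearMap.congr_fun hl φ)

theorem isMatlisReflexive_of_forall (h : ∀ ξ : MatlisDual R (MatlisDual R L),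
    ∃ l : L, ∀ φ : MatlisDual R L, φ l = ξ φ) : IsMatlisReflexive R L :=
  ⟨matlisBidual_injective, fun ξ => (h ξ).imp fun _ hl => LinearMap.ext hl⟩

variable {L₁ L₂ : Type u} [AddCommGroup L₁] [Module R L₁] [AddCommGroup L₂] [Module R L₂]

theorem IsMatlisReflexive.of_injective (h : IsMatlisReflexive R L) (f : L₁ →ₗ[R] L)
    (hf : Function.Injective f) : IsMatlisReflexive R L₁ := by
  refine isMatlisReflexive_of_forall fun ξ => ?_
  obtain ⟨l, hl⟩ := h.exists_forall (ξ ∘ₗ LinearMap.lcomp R (MatlisModule R) f)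
  -- Otherwise a functional vanishing on the range of `f` would be nonzero at `l`.
  have hlf : l ∈ LinearMap.range f := by
    by_contra hne
    obtain ⟨ψ, hψ⟩ := exists_matlisDual_apply_ne_zero (R := R)
      (l := (LinearMap.range f).mkQ l) (by simpa using hne)
    apply hψ
    have h0 : LinearMap.lcomp R (MatlisModule R) f (ψ ∘ₗ (LinearMap.range f).mkQ) = 0 := by
      ext x : 1
      have : (LinearMap.range f).mkQ (f x) = 0 := by simp
      simp only [LinearMap.lcomp_apply, LinearMap.comp_apply, this, map_zero,
        LinearMap.zero_apply]
    exact (hl (ψ ∘ₗ (LinearMap.range f).mkQ)).trans (by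
      rw [LinearMap.comp_apply, h0, map_zero])
  obtain ⟨l₁, rfl⟩ := hlf
  refine ⟨l₁, fun φ => ?_⟩
  obtain ⟨ψ, hψ⟩ := (injective_matlisModule R).out f hf φ
  have : LinearMap.lcomp R (MatlisModule R) f ψ = φ := LinearMap.ext hψ
  rw [← this]
  exact hl ψ

theorem IsMatlisReflexive.of_surjective (h : IsMatlisReflexive R L) (g : L →ₗ[R] L₂)
    (hg : Function.Surjective g) : IsMatlisReflexive R L₂ := by
  refine isMatlisReflexive_of_forall fun ξ => ?_
  obtain ⟨ξ', hξ'⟩ := (injective_matlisModule R).out (LinearMap.lcomp R (MatlisModule R) g)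
    (LinearMap.lcomp_injective_of_surjective g hg) ξ
  obtain ⟨l, hl⟩ := h.exists_forall ξ'
  exact ⟨g l, fun φ => (hl _).trans (hξ' φ)⟩

theorem IsMatlisReflexive.of_exact (h₁ : IsMatlisReflexive R L₁) (h₂ : IsMatlisReflexive R L₂)
    (f : L₁ →ₗ[R] L) (g : L →ₗ[R] L₂) (hfg : Function.Exact f g)
    (hg : Function.Surjective g) : IsMatlisReflexive R L := by
  refine isMatlisReflexive_of_forall fun ξ => ?_
  obtain ⟨l₂, hl₂⟩ := h₂.exists_forall (ξ ∘ₗ LinearMap.lcomp R (MatlisModule R) g)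
  obtain ⟨l, rfl⟩ := hg l₂
  -- After this correction ξ' vanishes on all functionals that factor through `g`, which are those
  -- killed by restriction along `f`. Hence ξ' factors through the restriction `d` and, by
  -- injectivity of E_R, extends to the whole dual of `L₁`.
  set ξ' := ξ - matlisBidual R L l with hξ'
  let d : MatlisDual R L →ₗ[R] MatlisDual R L₁ := LinearMap.lcomp R (MatlisModule R) f
  have hker : LinearMap.ker d ≤ LinearMap.ker ξ' := by
    intro ψ hψ
    have hψ' (x : L₁) : ψ (f x) = 0 := LinearMap.congr_fun hψ x
    let χ : L₂ →ₗ[R] MatlisModule R := ((LinearMap.ker g).liftQ ψ (by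
      intro y hy
      obtain ⟨x, rfl⟩ := (hfg y).1 hy
      exact hψ' x)) ∘ₗ (g.quotKerEquivOfSurjective hg).symm.toLinearMap
    have hχ : LinearMap.lcomp R (MatlisModule R) g χ = ψ := by
      ext1 y
      have : (g.quotKerEquivOfSurjective hg).symm (g y) = (LinearMap.ker g).mkQ y := by
        rw [LinearEquiv.symm_apply_eq]; rfl
      simp only [χ, LinearMap.lcomp_apply, LinearMap.comp_apply, LinearEquiv.coe_coe, this]
      rfl
    rw [LinearMap.mem_ker, hξ', LinearMap.sub_apply, sub_eq_zero, ← hχ]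
    exact (hl₂ χ).symm
  obtain ⟨η, hη⟩ := (injective_matlisModule R).out ((LinearMap.ker d).liftQ d le_rfl)
    (LinearMap.ker_eq_bot.1 (Submodule.ker_liftQ_eq_bot _ _ _ le_rfl))
    ((LinearMap.ker d).liftQ ξ' hker)
  obtain ⟨l₁, hl₁⟩ := h₁.exists_forall η
  refine ⟨f l₁ + l, fun φ => ?_⟩
  have h1 : φ (f l₁) = ξ' φ := (hl₁ (d φ)).trans (hη ((LinearMap.ker d).mkQ φ))
  rw [map_add, h1, hξ', LinearMap.sub_apply]
  exact sub_add_cancel _ _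

theorem IsMatlisReflexive.matlisDual (h : IsMatlisReflexive R L) :
    IsMatlisReflexive R (MatlisDual R L) := by
  refine isMatlisReflexive_of_forall fun ξ => ⟨ξ ∘ₗ matlisBidual R L, fun η => ?_⟩
  obtain ⟨l, rfl⟩ := h.2 η
  rfl

theorem IsMatlisReflexive.pi (h : IsMatlisReflexive R L) (n : ℕ) :
    IsMatlisReflexive R (Fin n → L) := by
  refine isMatlisReflexive_of_forall fun ξ => ?_
  choose l hl using fun i => h.exists_forall
    (ξ ∘ₗ LinearMap.lcomp R (MatlisModule R) (LinearMap.proj i : (Fin n → L) →ₗ[R] L))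
  refine ⟨l, fun φ => ?_⟩
  have hφ (x : Fin n → L) : φ x = ∑ i, φ (LinearMap.single R (fun _ => L) i (x i)) := by
    conv_lhs => rw [← Finset.univ_sum_single x, map_sum]
    rfl
  have hφ' : φ = ∑ i, LinearMap.lcomp R (MatlisModule R) (LinearMap.proj i : (Fin n → L) →ₗ[R] L)
      (φ ∘ₗ LinearMap.single R (fun _ => L) i) := by
    refine LinearMap.ext fun x => (hφ x).trans ?_
    rw [LinearMap.sum_apply]
    rfl
  rw [hφ l]
  conv_rhs => rw [hφ', map_sum]
  exact Finset.sum_congr rfl fun i _ => hl i (φ ∘ₗ LinearMap.single R (fun _ => L) i)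

end MatlisModule

/-! ### Reflexivity over complete semi-local quotients -/

section Reflexive

theorem ideal_map_comap_pow {R : Type u} [CommRing R] {I : Ideal R} (K : Ideal (R ⧸ I)) (n : ℕ) :
    ((K.comap (Ideal.Quotient.mk I)) ^ n ⊔ I).map (Ideal.Quotient.mk I) = K ^ n := by
  rw [Ideal.map_sup, Ideal.map_pow, Ideal.map_comap_of_surjective _ Ideal.Quotient.mk_surjective,
    Ideal.map_quotient_self, sup_bot_eq]

variable {R : Type u} [CommRing R] [IsNoetherianRing R]

theorem exists_pow_smul_matlisModule_eq_zero (e : MatlisModule R) (m : MaximalSpectrum R) :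
    ∃ n : ℕ, ∀ r ∈ m.asIdeal ^ n, r • e m = 0 :=
  (injectiveHull_spec R (R ⧸ m.asIdeal)).choose_spec.exists_pow_smul_eq_zero (e m)

theorem matlisModule_apply_eq_zero {e : MatlisModule R} {I : Ideal R} (he : ∀ r ∈ I, r • e = 0)
    {m : MaximalSpectrum R} (hm : ¬ I ≤ m.asIdeal) : e m = 0 := by
  obtain ⟨n, hn⟩ := exists_pow_smul_matlisModule_eq_zero e m
  have hsup : m.asIdeal ^ n ⊔ I = ⊤ :=
    Ideal.pow_sup_eq_top (m.isMaximal.out.2 _ (left_lt_sup.2 hm))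
  obtain ⟨r, hr, s, hs, hrs⟩ := Submodule.mem_sup.1 ((Ideal.eq_top_iff_one _).1 hsup)
  have hs' : s • e m = 0 := (DFinsupp.smul_apply s e m).symm.trans (by rw [he s hs]; rfl)
  rw [← one_smul R (e m), ← hrs, add_smul, hn r hr, hs', add_zero]

/-- The elements of E_R killed by `m` form a single copy of R/m, so the dual of R/m is again
one-dimensional over R/m. -/
theorem isMatlisReflexive_quotient_of_isMaximal (m : Ideal R) (hm : m.IsMaximal) :
    IsMatlisReflexive R (R ⧸ m) := by
  classical
  obtain ⟨f, hf⟩ := injectiveHull_spec R (R ⧸ m)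
  let j : injectiveHull R (R ⧸ m) →ₗ[R] MatlisModule R :=
    DirectSum.lof R (MaximalSpectrum R) (fun m => injectiveHull R (R ⧸ m.asIdeal)) ⟨m, hm⟩
  have hkill (e : MatlisModule R) (he : ∀ r ∈ m, r • e = 0) : ∃ r : R, e = r • j (f 1) := by
    have hmem : e ⟨m, hm⟩ ∈ LinearMap.range f := by
      refine hf.mem_range hm fun r hr => ?_
      exact (DFinsupp.smul_apply r e _).symm.trans (by rw [he r hr]; rfl)
    obtain ⟨x, hx⟩ := hmem
    obtain ⟨r, rfl⟩ := Ideal.Quotient.mk_surjective x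
    refine ⟨r, DFinsupp.ext fun n => ?_⟩
    have h1 : r • j (f 1) = j (e ⟨m, hm⟩) := by
      rw [← hx, ← map_smul, ← map_smul, Algebra.smul_def, mul_one]
      rfl
    rw [h1]
    by_cases hn : n = ⟨m, hm⟩
    · subst hn
      exact (DirectSum.of_eq_same (β := fun n : MaximalSpectrum R =>
        injectiveHull R (R ⧸ n.asIdeal)) _ _).symm
    · refine (matlisModule_apply_eq_zero he fun hle => hn ?_).trans
        (DirectSum.of_eq_of_ne (β := fun n : MaximalSpectrum R =>
          injectiveHull R (R ⧸ n.asIdeal)) _ _ _ hn).symm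
      exact MaximalSpectrum.ext (hm.eq_of_le n.isMaximal.ne_top hle).symm
  have hzero (r : R) (hr : r ∈ m) (x : R ⧸ m) : r • x = 0 := by
    rw [Algebra.smul_def, Ideal.Quotient.algebraMap_eq, Ideal.Quotient.eq_zero_iff_mem.2 hr, zero_mul]
  refine isMatlisReflexive_of_forall fun ξ => ?_
  obtain ⟨r, hr⟩ := hkill (ξ (j ∘ₗ f)) fun r hr => by
    have : r • (j ∘ₗ f) = 0 := LinearMap.ext fun x => by
      rw [LinearMap.smul_apply, ← map_smul, hzero r hr, map_zero, LinearMap.zero_apply]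
    rw [← map_smul, this, map_zero]
  refine ⟨Ideal.Quotient.mk m r, fun φ => ?_⟩
  obtain ⟨s, hs⟩ := hkill (φ 1) fun r hr => by rw [← map_smul, hzero r hr, map_zero]
  have hφ : φ = s • (j ∘ₗ f) := by
    refine LinearMap.ext fun x => ?_
    obtain ⟨t, rfl⟩ := Ideal.Quotient.mk_surjective x
    have ht : Ideal.Quotient.mk m t = t • 1 := by rw [Algebra.smul_def, mul_one]; rfl
    rw [ht, map_smul, map_smul, hs]
    rfl
  have hmk : Ideal.Quotient.mk m r = r • 1 := by rw [Algebra.smul_def, mul_one]; rfl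
  rw [hφ, map_smul, hr, hmk, map_smul, LinearMap.smul_apply, smul_comm]
  rfl

variable {L : Type u} [AddCommGroup L] [Module R L]

theorem IsMatlisReflexive.of_isFiniteLength (h : IsFiniteLength R L) : IsMatlisReflexive R L := by
  induction h with
  | of_subsingleton => exact isMatlisReflexive_of_forall fun ξ => ⟨0, fun φ => by
      rw [Subsingleton.elim φ 0, map_zero, map_zero]⟩
  | @of_simple_quotient L _ _ N hN _ ih =>
    obtain ⟨m, hm, ⟨e⟩⟩ := isSimpleModule_iff_quot_maximal.1 hN
    exact ih.of_exact ((isMatlisReflexive_quotient_of_isMaximal m hm).of_injective e.toLinearMap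
      e.injective) N.subtype N.mkQ (LinearMap.exact_subtype_mkQ N) N.mkQ_surjective

variable {I : Ideal R}

/-- A prime above a power of the Jacobson radical contains a finite intersection of maximal ideals,
hence one of them. -/
theorem isArtinianRing_quotient_jacobson_pow (hs : IsSemilocal (R ⧸ I)) (n : ℕ) :
    IsArtinianRing (R ⧸ ((Ring.jacobson (R ⧸ I)).comap (Ideal.Quotient.mk I) ^ n ⊔ I)) := by
  rw [isArtinianRing_quotient_iff]
  intro p hp hle
  have : Finite (MaximalSpectrum (R ⧸ I)) := hs
  have := Fintype.ofFinite (MaximalSpectrum (R ⧸ I))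
  have hJ : (Ring.jacobson (R ⧸ I)).comap (Ideal.Quotient.mk I) ≤ p :=
    hp.le_of_pow_le (le_sup_left.trans hle)
  have hinf : Finset.univ.inf (fun m : MaximalSpectrum (R ⧸ I) =>
      m.asIdeal.comap (Ideal.Quotient.mk I)) ≤ p := by
    refine le_trans (fun r hr => ?_) hJ
    rw [Submodule.mem_finsetInf] at hr
    rw [Ideal.mem_comap, Ring.jacobson_eq_sInf_isMaximal, Ideal.mem_sInf]
    exact fun {K} hK => hr ⟨K, hK⟩ (Finset.mem_univ _)
  obtain ⟨m, -, hm⟩ := hp.inf_le'.1 hinf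
  have := m.isMaximal
  have hmax := Ideal.comap_isMaximal_of_surjective (Ideal.Quotient.mk I)
    Ideal.Quotient.mk_surjective (K := m.asIdeal)
  rwa [← hmax.eq_of_le hp.ne_top hm]

/-- Such an `e` has finitely many nonzero components, all at maximal ideals above `I`, and each is
killed by a power of its ideal. Hence maps from R/I to E_R factor through a finite-length
truncation. -/
theorem exists_pow_jacobson_smul_eq_zero {e : MatlisModule R} (he : ∀ r ∈ I, r • e = 0) :
    ∃ n : ℕ, ∀ r ∈ (Ring.jacobson (R ⧸ I)).comap (Ideal.Quotient.mk I) ^ n ⊔ I, r • e = 0 := by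
  classical
  choose k hk using exists_pow_smul_matlisModule_eq_zero e
  refine ⟨(DFinsupp.support e).sup k, fun r hr => ?_⟩
  obtain ⟨s, hs, t, ht, rfl⟩ := Submodule.mem_sup.1 hr
  rw [add_smul, he t ht, add_zero]
  refine DFinsupp.ext fun m => (DFinsupp.smul_apply s e m).trans ?_
  by_cases hm : e m = 0
  · rw [hm, smul_zero]; rfl
  have hle : I ≤ m.asIdeal := by
    by_contra h
    exact hm (matlisModule_apply_eq_zero he h)
  have hJ : (Ring.jacobson (R ⧸ I)).comap (Ideal.Quotient.mk I) ≤ m.asIdeal := by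
    have := m.isMaximal
    have hmax : (m.asIdeal.map (Ideal.Quotient.mk I)).IsMaximal :=
      Ideal.IsMaximal.map_of_surjective_of_ker_le Ideal.Quotient.mk_surjective
        (by rwa [Ideal.mk_ker])
    refine (Ideal.comap_mono (Ring.jacobson_le_of_isMaximal
      (m.asIdeal.map (Ideal.Quotient.mk I)))).trans ?_
    rw [Ideal.comap_map_of_surjective' _ Ideal.Quotient.mk_surjective, Ideal.mk_ker,
      sup_eq_left.2 hle]
  exact hk m s (Ideal.pow_right_mono hJ _ (Ideal.pow_le_pow_right
    (Finset.le_sup (DFinsupp.mem_support_iff.2 hm)) hs))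

theorem isMatlisReflexive_quotient (hs : IsSemilocal (R ⧸ I)) (hc : IsJacobsonComplete (R ⧸ I)) :
    IsMatlisReflexive R (R ⧸ I) := by
  set J := Ring.jacobson (R ⧸ I) with hJ
  let F (n : ℕ) : Ideal R := J.comap (Ideal.Quotient.mk I) ^ n ⊔ I
  have hF {m n : ℕ} (h : m ≤ n) : F n ≤ F m := sup_le_sup_right (Ideal.pow_le_pow_right h) _
  have hmem {n : ℕ} {r : R} : Ideal.Quotient.mk I r ∈ J ^ n ↔ r ∈ F n := by
    rw [← ideal_map_comap_pow, ← Ideal.mem_comap,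
      Ideal.comap_map_of_surjective' _ Ideal.Quotient.mk_surjective, Ideal.mk_ker, sup_assoc,
      sup_idem]
  have hrefl (n : ℕ) : IsMatlisReflexive R (R ⧸ F n) := by
    have := isArtinianRing_quotient_jacobson_pow hs n
    exact IsMatlisReflexive.of_isFiniteLength (IsMinimax.of_isNoetherian.isFiniteLength
      (I := F n) Ideal.annihilator_quotient.ge)
  refine isMatlisReflexive_of_forall fun ξ => ?_
  -- On the reflexive truncation `R ⧸ F n`, ξ is evaluation at a class `s n`. These classes are
  -- compatible because functionals separate points, and completeness provides their limit `l`.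
  let π (n : ℕ) : (R ⧸ I) →ₗ[R] R ⧸ F n := Submodule.factor le_sup_right
  have hs (n : ℕ) : ∃ s : R, ∀ ψ : MatlisDual R (R ⧸ F n),
      ψ (Submodule.Quotient.mk s) = ξ (ψ ∘ₗ π n) := by
    obtain ⟨l, hl⟩ := (hrefl n).exists_forall (ξ ∘ₗ LinearMap.lcomp R (MatlisModule R) (π n))
    obtain ⟨s, rfl⟩ := Submodule.Quotient.mk_surjective _ l
    exact ⟨s, hl⟩
  choose s hs using hs
  have hcauchy {m n : ℕ} (h : m ≤ n) : s m - s n ∈ F m := by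
    rw [← Submodule.Quotient.eq]
    by_contra hne
    obtain ⟨ψ, hψ⟩ := exists_matlisDual_apply_ne_zero (R := R) (sub_ne_zero.2 hne)
    rw [map_sub, sub_ne_zero] at hψ
    refine hψ ((hs m ψ).trans ?_)
    exact ((congrArg ξ (LinearMap.ext fun x => by
      obtain ⟨x, rfl⟩ := Submodule.Quotient.mk_surjective _ x
      rfl)).trans (hs n (ψ ∘ₗ Submodule.factor (hF h))).symm)
  obtain ⟨l, hl⟩ := hc.toIsPrecomplete.prec' (fun n => Ideal.Quotient.mk I (s n)) fun {m n} h => by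
    rw [SModEq.sub_mem, smul_eq_mul, Ideal.mul_top, ← map_sub]
    exact hmem.2 (hcauchy h)
  obtain ⟨l, rfl⟩ := Ideal.Quotient.mk_surjective l
  refine ⟨Ideal.Quotient.mk I l, fun φ => ?_⟩
  obtain ⟨n, hn⟩ := exists_pow_jacobson_smul_eq_zero (I := I) (e := φ 1) fun r hr => by
    rw [← map_smul, Algebra.smul_def, Ideal.Quotient.algebraMap_eq,
      Ideal.Quotient.eq_zero_iff_mem.2 hr, zero_mul, map_zero]
  have hφ (r : R) : φ (Submodule.Quotient.mk r) = r • φ 1 := by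
    rw [← map_smul, Algebra.smul_def, mul_one]
    rfl
  let ψ : MatlisDual R (R ⧸ F n) := (F n).liftQ (LinearMap.toSpanSingleton R _ (φ 1)) hn
  have hψ : ψ ∘ₗ π n = φ := LinearMap.ext fun x => by
    obtain ⟨x, rfl⟩ := Submodule.Quotient.mk_surjective _ x
    exact (hφ x).symm
  have hl' : s n - l ∈ F n := by
    have := hl n
    rw [SModEq.sub_mem, smul_eq_mul, Ideal.mul_top, ← map_sub] at this
    exact hmem.1 this
  have h1 : (Submodule.Quotient.mk (s n) : R ⧸ F n) = Submodule.Quotient.mk l :=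
    (Submodule.Quotient.eq _).2 hl'
  rw [← hψ, ← hs n ψ, h1]
  rfl

/-- Finitely many maps to the Matlis module separate the elements of an artinian module. -/
theorem exists_finset_forall_matlisDual [IsArtinian R L] :
    ∃ t : Finset (MatlisDual R L), ∀ l : L, (∀ φ ∈ t, φ l = 0) → l = 0 := by
  classical
  obtain ⟨_, ⟨t, rfl⟩, hmin⟩ := IsArtinian.set_has_minimal
    (Set.range fun t : Finset (MatlisDual R L) => t.inf LinearMap.ker) ⟨_, ⟨∅, rfl⟩⟩
  refine ⟨t, fun l hl => ?_⟩
  by_contra hne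
  obtain ⟨φ, hφ⟩ := exists_matlisDual_apply_ne_zero (R := R) hne
  refine hmin _ ⟨insert φ t, rfl⟩ (lt_of_le_of_ne ?_ fun h => hφ ?_)
  · exact Finset.inf_mono (Finset.subset_insert φ t)
  · have hl' : l ∈ t.inf LinearMap.ker := Submodule.mem_finsetInf.2 hl
    dsimp only at h
    rw [← h] at hl'
    exact Submodule.mem_finsetInf.1 hl' φ (Finset.mem_insert_self φ t)

/-- A mini-max module which is killed by an ideal with complete semi-local quotient ring is
Matlis reflexive. -/
theorem IsMinimax.isMatlisReflexive (hs : IsSemilocal (R ⧸ I)) (hc : IsJacobsonComplete (R ⧸ I))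
    (hI : I ≤ Module.annihilator R L) (hL : IsMinimax R L) : IsMatlisReflexive R L := by
  have hS := isMatlisReflexive_quotient hs hc
  obtain ⟨N, hN, hA⟩ := hL
  have h₁ : IsMatlisReflexive R N := by
    have htor : Module.IsTorsionBySet R N I := fun x r => Subtype.ext
      (Module.mem_annihilator.1 (hI r.2) x)
    let := htor.module
    have : IsScalarTower R (R ⧸ I) N := htor.isScalarTower
    have : Module.Finite (R ⧸ I) N := Module.Finite.of_restrictScalars_finite R (R ⧸ I) N
    obtain ⟨n, f, hf⟩ := Module.Finite.exists_fin' (R ⧸ I) N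
    exact (hS.pi n).of_surjective (f.restrictScalars R) hf
  have h₂ : IsMatlisReflexive R (L ⧸ N) := by
    have htor : Module.IsTorsionBySet R (L ⧸ N) I := fun x r => by
      obtain ⟨x, rfl⟩ := N.mkQ_surjective x
      rw [← map_smul, Module.mem_annihilator.1 (hI r.2) x, map_zero]
    let := htor.module
    have : IsScalarTower R (R ⧸ I) (L ⧸ N) := htor.isScalarTower
    obtain ⟨t, ht⟩ := exists_finset_forall_matlisDual (R := R) (L := L ⧸ N)
    -- Each separating functional φ yields the map sending x to the functional s ↦ φ(s x) on R/I;
    -- evaluating at s = 1 recovers φ(x), whence injectivity.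
    let f : (L ⧸ N) →ₗ[R] Fin t.card → MatlisDual R (R ⧸ I) :=
      LinearMap.pi fun i =>
        { toFun := fun x => (t.equivFin.symm i).1 ∘ₗ
            (LinearMap.toSpanSingleton (R ⧸ I) (L ⧸ N) x).restrictScalars R
          map_add' := fun x y => LinearMap.ext fun s => by simp
          map_smul' := fun r x => LinearMap.ext fun s => by
            simp [smul_comm s r x] }
    refine (hS.matlisDual.pi t.card).of_injective f ?_
    rw [injective_iff_map_eq_zero]
    refine fun x hx => ht x fun φ hφ => ?_
    have := LinearMap.congr_fun (congrFun hx (t.equivFin ⟨φ, hφ⟩)) 1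
    simpa [f] using this
  exact h₁.of_exact h₂ N.subtype N.mkQ (LinearMap.exact_subtype_mkQ N) N.mkQ_surjective

end Reflexive
end MatlisTor

theorem mainTheorem7 {R : Type u} [CommRing R] [IsNoetherianRing R]
    {M M' : Type u} [AddCommGroup M] [Module R M] [AddCommGroup M'] [Module R M']
    (hM : MatlisTor.IsMinimax R M) (hM' : MatlisTor.IsMinimax R M') (i : ℕ) :
    MatlisTor.IsMinimax R (MatlisTor.TorModule R i M M') ∧
    (MatlisTor.IsSemilocal (R ⧸ (Module.annihilator R M ⊔ Module.annihilator R M')) →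
      MatlisTor.IsJacobsonComplete (R ⧸ (Module.annihilator R M ⊔ Module.annihilator R M')) →
      MatlisTor.IsMatlisReflexive R (MatlisTor.TorModule R i M M')) ∧
    (IsArtinianRing (R ⧸ (Module.annihilator R M ⊔ Module.annihilator R M')) →
      IsFiniteLength R (MatlisTor.TorModule R i M M')) := by
  have hmm := MatlisTor.isMinimax_tor hM hM' i
  have hann : Module.annihilator R M ⊔ Module.annihilator R M' ≤
      Module.annihilator R (MatlisTor.TorModule R i M M') :=
    sup_le (MatlisTor.annihilator_le_annihilator_tor_left i)
      (MatlisTor.annihilator_le_annihilator_tor_right i)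
  exact ⟨hmm, fun hs hc => hmm.isMatlisReflexive hs hc hann, fun _ => hmm.isFiniteLength hann⟩
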